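/- **Setting.** Fix $n\ge 1$ and $0<\gamma<1$; functions are real- or complex-valued. Cubes $Q\subset\mathbb R^n$ have sides parallel to the axes, and $2^mQ$ is the cube with the same center as $Q$ and $2^m$ times its side length. A *Young function* is a continuous nondecreasing $A:[0,\infty)\to[0,\infty)$ with $A(0)=0$ such that either $A$ is convex and $A(t)\to\infty$ as $t\to\infty$, or $A(t)/t\to\infty$ as $t\to\infty$; its conjugate is $\overline A(t)=\sup_{u\ge0}(ut-A(u))\in[0,\infty]$. For $\Phi=A$ or $\Phi=\overline A$ put $$\|f\|_{L^\Phi(Q)}=\inf\Big\{\lambda>0:\frac1{|Q|}\int_Q\Phi\Big(\frac{|f(y)|}\lambda\Big)\,dy\le1\Big\},\qquad M_{\gamma,\Phi}f(x)=\sup_{Q\ni x}|Q|^\gamma\|f\|_{L^\Phi(Q)},$$ and for $0<s\le 1/2$, a cube $Q_0$ and $x\in Q_0$ put $$M^\sharp_{0,s,Q_0}g(x)=\sup_{x\in Q,\,Q\subset Q_0}\ \inf_c\ \inf\{\alpha\ge0:|\{y\in Q:|g(y)-c|>\alpha\}|<s|Q|\},$$ where $c$ ranges over the scalars. **Theorem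 2.2.** Let $k(x,y)$ be a measurable kernel on $\mathbb R^n\times\mathbb R^n$ and $Tf(x)=\int_{\mathbb R^n}k(x,y)f(y)\,dy$, defined for those measurable $f$ for which the integral converges absolutely for almost every $x$. Suppose that $T$ is of weak type $(1,1/(1-\gamma))$, i.e. there is a constant $C$ with $$t\,|\{x:|Tf(x)|>t\}|^{1-\gamma}\le C\|f\|_{L^1}$$ for all $t>0$ and all $f\in L^1(\mathbb R^n)$ for which $Tf$ is defined, and that for a Young function $A$ there is a constant $c_A<\infty$ such that for every cube $Q$ and all $u,v\in Q$, $$\sum_{m=1}^\infty|2^{m+1}Q|^{1-\gamma}\,\big\|\mathbf 1_{2^{m+1}Q\setminus2^mQ}\,(k(u,\cdot)-k(v,\cdot))\big\|_{L^A(2^{m+1}Q)}\le c_A .$$ Then for every $0<s\le1/2$ there is a constant $c<\infty$, independent of $f$, $Q_0$ and $x$, such that for every $f$ for which $Tf$ is defined, every cube $Q_0$ and every $x\in Q_0$, $$M^\sharp_{0,s,Q_0}(Tf)(x)\le c\,\sup_{x\in Q,\,Q\subset Q_0}\ \inf_{y\in Q}M_{\gamma,\overline A}f(y).$$ -/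

import Mathlib

open MeasureTheory Filter
open scoped NNReal ENNReal Topology

noncomputable section

namespace FracInt

/-- A (nondegenerate, closed) cube of `ℝⁿ` with sides parallel to the axes, given by its center
and half of its side length. -/
structure Cube (n : ℕ) where
  center : Fin n → ℝ
  halfSide : ℝ
  halfSide_pos : 0 < halfSide

namespace Cube

variable {n : ℕ}

/-- The set of points of a cube. -/
def toSet (Q : Cube n) : Set (Fin n → ℝ) :=
  {y | ∀ i, |y i - Q.center i| ≤ Q.halfSide}

/-- The cube `2 ^ j Q`: same center as `Q`, side length multiplied by `2 ^ j`. -/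
def dyadicDilate (Q : Cube n) (j : ℕ) : Cube n where
  center := Q.center
  halfSide := 2 ^ j * Q.halfSide
  halfSide_pos := mul_pos (pow_pos two_pos j) Q.halfSide_pos

end Cube

/-- Young functions on `[0, ∞)`. Neither strict monotonicity nor the doubling condition
`A (2 t) ≤ c A t` is required. -/
structure IsYoung (A : ℝ≥0 → ℝ≥0) : Prop where
  continuous : Continuous A
  monotone : Monotone A
  map_zero : A 0 = 0
  growth : (ConvexOn ℝ≥0 Set.univ A ∧ Tendsto A atTop atTop) ∨
    Tendsto (fun t => A t / t) atTop atTop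

/-- The conjugate function `Ā t = sup_{u ≥ 0} (u t - A u)`, with values in `[0, ∞]`. The
subtraction is truncated at `0`, which does not change the supremum when `A 0 = 0`, because
`u = 0` contributes `0`. -/
def conjugate (A : ℝ≥0 → ℝ≥0) (t : ℝ≥0) : ℝ≥0∞ :=
  ⨆ u : ℝ≥0, ((u : ℝ≥0∞) * (t : ℝ≥0∞) - (A u : ℝ≥0∞))

section Functionals

variable {n : ℕ} {𝕜 : Type*} [RCLike 𝕜]

/-- The averaged Luxemburg functional `‖f‖_{L^Φ(Q)}`, the infimum of the `lam > 0` for which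
`|Q|⁻¹ ∫_Q Φ (|f| / lam) ≤ 1`; it is `∞` if there is no such `lam`. -/
def luxNorm (Φ : ℝ≥0 → ℝ≥0∞) (f : (Fin n → ℝ) → 𝕜) (Q : Cube n) : ℝ≥0∞ :=
  ⨅ (lam : ℝ≥0) (_ : 0 < lam)
    (_ : (volume Q.toSet)⁻¹ * ∫⁻ y in Q.toSet, Φ (‖f y‖₊ / lam) ≤ 1), (lam : ℝ≥0∞)

/-- The fractional maximal function
`M_{γ,Φ} f (x) = sup_{Q ∋ x} |Q| ^ γ ‖f‖_{L^Φ(Q)}`, over all cubes `Q` containing `x`. -/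
def fracMaximal (γ : ℝ) (Φ : ℝ≥0 → ℝ≥0∞) (f : (Fin n → ℝ) → 𝕜) (x : Fin n → ℝ) : ℝ≥0∞ :=
  ⨆ (Q : Cube n) (_ : x ∈ Q.toSet), volume Q.toSet ^ γ * luxNorm Φ f Q

/-- The local sharp maximal function restricted to the cube `Q₀`,
`sup_{x ∈ Q ⊆ Q₀} inf_c inf {α ≥ 0 : |{y ∈ Q : |f y - c| > α}| < s |Q|}`. -/
def localSharp (s : ℝ) (Q₀ : Cube n) (f : (Fin n → ℝ) → 𝕜) (x : Fin n → ℝ) : ℝ≥0∞ :=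
  ⨆ (Q : Cube n) (_ : x ∈ Q.toSet) (_ : Q.toSet ⊆ Q₀.toSet),
    ⨅ (c : 𝕜) (α : ℝ≥0)
      (_ : volume {y | y ∈ Q.toSet ∧ (α : ℝ) < ‖f y - c‖} < ENNReal.ofReal s * volume Q.toSet),
      (α : ℝ≥0∞)

/-- The integral operator `T f (x) = ∫ k(x, y) f(y) dy`. -/
def intOp (k : (Fin n → ℝ) → (Fin n → ℝ) → 𝕜) (f : (Fin n → ℝ) → 𝕜) (x : Fin n → ℝ) : 𝕜 :=
  ∫ y, k x y * f y

/-- `f` lies in the natural domain of the integral operator with kernel `k`: it is measurable, and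
the integral defining `T f (x)` converges absolutely for almost every `x`. -/
def InDomain (k : (Fin n → ℝ) → (Fin n → ℝ) → 𝕜) (f : (Fin n → ℝ) → 𝕜) : Prop :=
  AEStronglyMeasurable f volume ∧ ∀ᵐ x, Integrable (fun y => k x y * f y) volume

/-- The integral operator with kernel `k` is of weak type `(p, q)`: there is a constant `C` with
`t |{|T f| > t}| ^ (1 / q) ≤ C ‖f‖_p` for all `t > 0` and all `f ∈ L ^ p` for which `T f` is
defined. -/
def IsWeakType (k : (Fin n → ℝ) → (Fin n → ℝ) → 𝕜) (p : ℝ≥0∞) (q : ℝ) : Prop :=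
  ∃ C : ℝ≥0, ∀ f : (Fin n → ℝ) → 𝕜, InDomain k f → MemLp f p volume →
    ∀ t : ℝ≥0, 0 < t →
      (t : ℝ≥0∞) * volume {x | (t : ℝ) < ‖intOp k f x‖} ^ (1 / q) ≤ C * eLpNorm f p volume

/-- The `L^A` Hörmander-type condition of order `γ`: there is a finite constant `c` such that, for
every cube `Q` and all `u, v ∈ Q`,
`∑_{m ≥ 1} |2^{m+1}Q|^{1-γ} ‖1_{2^{m+1}Q \ 2^m Q} (k(u, ·) - k(v, ·))‖_{L^A(2^{m+1}Q)} ≤ c`.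
The sum is indexed from `0`, the index `j` standing for `m = j + 1`. -/
def IsHormander (γ : ℝ) (A : ℝ≥0 → ℝ≥0) (k : (Fin n → ℝ) → (Fin n → ℝ) → 𝕜) : Prop :=
  ∃ c : ℝ≥0, ∀ Q : Cube n, ∀ u ∈ Q.toSet, ∀ v ∈ Q.toSet,
    ∑' j : ℕ, volume (Q.dyadicDilate (j + 2)).toSet ^ (1 - γ) *
      luxNorm (fun t => (A t : ℝ≥0∞))
        (((Q.dyadicDilate (j + 2)).toSet \ (Q.dyadicDilate (j + 1)).toSet).indicator
          (fun y => k u y - k v y))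
        (Q.dyadicDilate (j + 2)) ≤ c

end Functionals

end FracInt

end

/-! Fix a cube `Q` and a point `y ∈ Q`, and split `f` into `f₁ = f 1_{2Q}` and `f₂ = f - f₁`.
Hölder's inequality for the conjugate pair `A`, `Ā` bounds integrals against `f` over any cube
containing `y` by `M_{γ,Ā} f (y)`. Pairing `f` with `1` on `2Q` gives
`‖f₁‖₁ ≲ |Q| ^ (1 - γ) M_{γ,Ā} f (y)`, so that the weak type of `T` bounds `T f₁` by a multiple of
`M_{γ,Ā} f (y)` outside a subset of `Q` of measure less than `s |Q|`. Pairing `f` with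
`k(u, ·) - k(v, ·)` on the dyadic annuli around `Q` and summing shows that `T f₂` oscillates by at
most `2 c_A M_{γ,Ā} f (y)` on `Q`, so a value of `T f₂` on `Q` is an admissible constant in the
sharp functional. -/

namespace FracInt

variable {n : ℕ} {𝕜 : Type*} [RCLike 𝕜]

namespace Cube

theorem toSet_eq_closedBall (Q : Cube n) : Q.toSet = Metric.closedBall Q.center Q.halfSide := by
  ext y
  simp [toSet, dist_pi_le_iff Q.halfSide_pos.le, Real.dist_eq]

theorem measurableSet_toSet (Q : Cube n) : MeasurableSet Q.toSet :=
  Q.toSet_eq_closedBall ▸ Metric.isClosed_closedBall.measurableSet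

theorem volume_toSet (Q : Cube n) : volume Q.toSet = ENNReal.ofReal ((2 * Q.halfSide) ^ n) := by
  rw [toSet_eq_closedBall, Real.volume_pi_closedBall _ Q.halfSide_pos.le, Fintype.card_fin]

theorem volume_toSet_ne_zero (Q : Cube n) : volume Q.toSet ≠ 0 := by
  have := Q.halfSide_pos
  rw [volume_toSet, ENNReal.ofReal_ne_zero_iff]
  positivity

theorem volume_toSet_ne_top (Q : Cube n) : volume Q.toSet ≠ ⊤ :=
  Q.volume_toSet ▸ ENNReal.ofReal_ne_top

theorem volume_toSet_rpow_ne_zero (Q : Cube n) (p : ℝ) : volume Q.toSet ^ p ≠ 0 :=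
  (ENNReal.rpow_pos (pos_iff_ne_zero.2 Q.volume_toSet_ne_zero) Q.volume_toSet_ne_top).ne'

theorem volume_toSet_rpow_ne_top (Q : Cube n) (p : ℝ) : volume Q.toSet ^ p ≠ ⊤ :=
  ENNReal.rpow_ne_top_of_ne_zero Q.volume_toSet_ne_zero Q.volume_toSet_ne_top

theorem volume_dyadicDilate (Q : Cube n) (j : ℕ) :
    volume (Q.dyadicDilate j).toSet = (2 ^ j) ^ n * volume Q.toSet := by
  have hside : 2 * (Q.dyadicDilate j).halfSide = 2 ^ j * (2 * Q.halfSide) := by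
    simp only [dyadicDilate]
    ring
  rw [volume_toSet, volume_toSet, hside, mul_pow, ENNReal.ofReal_mul (by positivity)]
  norm_num [ENNReal.ofReal_pow]

theorem subset_dyadicDilate (Q : Cube n) (j : ℕ) : Q.toSet ⊆ (Q.dyadicDilate j).toSet :=
  fun _ hy i => (hy i).trans <|
    le_mul_of_one_le_left Q.halfSide_pos.le (one_le_pow₀ one_le_two)

theorem exists_mem_dyadicDilate (Q : Cube n) (y : Fin n → ℝ) :
    ∃ j, y ∈ (Q.dyadicDilate j).toSet := by
  obtain ⟨j, hj⟩ := pow_unbounded_of_one_lt (dist y Q.center / Q.halfSide) one_lt_two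
  refine ⟨j, ?_⟩
  rw [toSet_eq_closedBall, Metric.mem_closedBall]
  exact ((div_lt_iff₀ Q.halfSide_pos).1 hj).le

/-- The dyadic annulus `2 ^ (j + 2) Q \ 2 ^ (j + 1) Q`, which carries the `j`-th term of the sum in
`IsHormander`. -/
def annulus (Q : Cube n) (j : ℕ) : Set (Fin n → ℝ) :=
  (Q.dyadicDilate (j + 2)).toSet \ (Q.dyadicDilate (j + 1)).toSet

theorem annulus_subset (Q : Cube n) (j : ℕ) : Q.annulus j ⊆ (Q.dyadicDilate (j + 2)).toSet :=
  Set.sdiff_subset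

theorem measurableSet_annulus (Q : Cube n) (j : ℕ) : MeasurableSet (Q.annulus j) :=
  (measurableSet_toSet _).diff (measurableSet_toSet _)

theorem compl_dyadicDilate_one_subset_iUnion_annulus (Q : Cube n) :
    (Q.dyadicDilate 1).toSetᶜ ⊆ ⋃ j, Q.annulus j := by
  intro y hy
  by_contra hannulus
  simp only [annulus, Set.mem_iUnion, Set.mem_sdiff, not_exists, not_and_not_right] at hannulus
  have houtside (j : ℕ) : y ∉ (Q.dyadicDilate (j + 1)).toSet := by
    induction j with
    | zero => exact hy
    | succ j ih => exact fun h => ih (hannulus j h)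
  obtain ⟨j, hj⟩ := Q.exists_mem_dyadicDilate y
  cases j with
  | zero => exact hy (Q.subset_dyadicDilate 1 (by simpa [dyadicDilate, toSet] using hj))
  | succ j => exact houtside j hj

end Cube

section Luxemburg

variable {A : ℝ≥0 → ℝ≥0} {Φ : ℝ≥0 → ℝ≥0∞} {f g : (Fin n → ℝ) → 𝕜} {Q : Cube n}

theorem mul_le_add_conjugate (A : ℝ≥0 → ℝ≥0) (u t : ℝ≥0) :
    (u : ℝ≥0∞) * t ≤ A u + conjugate A t :=
  tsub_le_iff_left.1 (le_iSup (fun u : ℝ≥0 => (u : ℝ≥0∞) * t - A u) u)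

theorem measurable_conjugate (A : ℝ≥0 → ℝ≥0) : Measurable (conjugate A) :=
  (lowerSemicontinuous_iSup fun _ => ((ENNReal.continuous_sub_right _).comp
    ((ENNReal.continuous_const_mul ENNReal.coe_ne_top).comp
      ENNReal.continuous_coe)).lowerSemicontinuous).measurable

theorem exists_lintegral_le_volume_of_luxNorm_lt {a : ℝ≥0∞} (h : luxNorm Φ f Q < a) :
    ∃ l : ℝ≥0, 0 < l ∧ ∫⁻ y in Q.toSet, Φ (‖f y‖₊ / l) ≤ volume Q.toSet ∧ l < a := by
  simp only [luxNorm, iInf_lt_iff] at h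
  obtain ⟨l, hl, hint, hla⟩ := h
  refine ⟨l, hl, ?_, hla⟩
  rwa [mul_comm, ← div_eq_mul_inv,
    ENNReal.div_le_iff Q.volume_toSet_ne_zero Q.volume_toSet_ne_top, one_mul] at hint

theorem luxNorm_one_le {t : ℝ≥0} (ht : 0 < t) (hΦ : Φ t ≤ 1) :
    luxNorm Φ (fun _ => (1 : 𝕜)) Q ≤ (t⁻¹ : ℝ≥0) := by
  refine iInf₂_le_of_le t⁻¹ (inv_pos.2 ht) (iInf_le_of_le ?_ le_rfl)
  simp only [nnnorm_one, one_div, inv_inv, setLIntegral_const]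
  rwa [mul_left_comm, ENNReal.inv_mul_cancel Q.volume_toSet_ne_zero Q.volume_toSet_ne_top, mul_one]

theorem lintegral_enorm_mul_le_of_lintegral_le_volume (hf : AEStronglyMeasurable f volume)
    {l r : ℝ≥0} (hl : 0 < l) (hr : 0 < r)
    (hgA : ∫⁻ y in Q.toSet, A (‖g y‖₊ / l) ≤ volume Q.toSet)
    (hfA : ∫⁻ y in Q.toSet, conjugate A (‖f y‖₊ / r) ≤ volume Q.toSet) :
    ∫⁻ y in Q.toSet, ‖g y‖ₑ * ‖f y‖ₑ ≤ 2 * volume Q.toSet * (l * r) := by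
  have young (y : Fin n → ℝ) : ‖g y‖ₑ * ‖f y‖ₑ ≤
      (l * r : ℝ≥0) * (A (‖g y‖₊ / l) + conjugate A (‖f y‖₊ / r)) := by
    have rescale : ‖g y‖ₑ * ‖f y‖ₑ =
        (l * r : ℝ≥0) * ((‖g y‖₊ / l : ℝ≥0) * (‖f y‖₊ / r : ℝ≥0)) := by
      rw [enorm_eq_nnnorm, enorm_eq_nnnorm]
      norm_cast
      field_simp
    rw [rescale]
    gcongr
    exact mul_le_add_conjugate _ _ _
  have hmeas : AEMeasurable (fun y => conjugate A (‖f y‖₊ / r)) (volume.restrict Q.toSet) :=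
    (measurable_conjugate A).comp_aemeasurable (hf.restrict.nnnorm.aemeasurable.div_const r)
  calc ∫⁻ y in Q.toSet, ‖g y‖ₑ * ‖f y‖ₑ
      ≤ ∫⁻ y in Q.toSet, (l * r : ℝ≥0) * (A (‖g y‖₊ / l) + conjugate A (‖f y‖₊ / r)) :=
        lintegral_mono young
    _ = (l * r : ℝ≥0) * ((∫⁻ y in Q.toSet, A (‖g y‖₊ / l)) +
          ∫⁻ y in Q.toSet, conjugate A (‖f y‖₊ / r)) := by
        rw [lintegral_const_mul' _ _ ENNReal.coe_ne_top, lintegral_add_right' _ hmeas]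
    _ ≤ (l * r : ℝ≥0) * (volume Q.toSet + volume Q.toSet) := by gcongr
    _ = 2 * volume Q.toSet * (l * r) := by push_cast; ring

theorem lintegral_enorm_mul_le_luxNorm_mul_luxNorm (hf : AEStronglyMeasurable f volume)
    (hgA : luxNorm (fun t => A t) g Q ≠ ⊤) (hfA : luxNorm (conjugate A) f Q ≠ ⊤) :
    ∫⁻ y in Q.toSet, ‖g y‖ₑ * ‖f y‖ₑ ≤
      2 * volume Q.toSet * (luxNorm (fun t => A t) g Q * luxNorm (conjugate A) f Q) := by
  have hvol : 2 * volume Q.toSet ≠ ⊤ :=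
    ENNReal.mul_ne_top ENNReal.ofNat_ne_top Q.volume_toSet_ne_top
  have hvol' : 2 * volume Q.toSet ≠ 0 := mul_ne_zero two_ne_zero Q.volume_toSet_ne_zero
  rw [← ENNReal.div_le_iff' hvol' hvol]
  refine ENNReal.le_mul_of_forall_lt (.inr hfA) (.inl hgA) fun a ha b hb => ?_
  obtain ⟨l, hl, hgl, hla⟩ := exists_lintegral_le_volume_of_luxNorm_lt ha
  obtain ⟨r, hr, hfr, hrb⟩ := exists_lintegral_le_volume_of_luxNorm_lt hb
  rw [ENNReal.div_le_iff' hvol' hvol]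
  calc ∫⁻ y in Q.toSet, ‖g y‖ₑ * ‖f y‖ₑ
      ≤ 2 * volume Q.toSet * (l * r) :=
        lintegral_enorm_mul_le_of_lintegral_le_volume hf hl hr hgl hfr
    _ ≤ 2 * volume Q.toSet * (a * b) := by gcongr

end Luxemburg

section FracMaximal

variable {γ : ℝ} {A : ℝ≥0 → ℝ≥0} {Φ : ℝ≥0 → ℝ≥0∞} {f g : (Fin n → ℝ) → 𝕜} {Q : Cube n}
  {y : Fin n → ℝ}

theorem volume_rpow_mul_luxNorm_le_fracMaximal (hy : y ∈ Q.toSet) :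
    volume Q.toSet ^ γ * luxNorm Φ f Q ≤ fracMaximal γ Φ f y :=
  le_iSup₂ (f := fun (Q : Cube n) (_ : y ∈ Q.toSet) => volume Q.toSet ^ γ * luxNorm Φ f Q) Q hy

theorem luxNorm_ne_top_of_fracMaximal_ne_top (hy : y ∈ Q.toSet) (hM : fracMaximal γ Φ f y ≠ ⊤) :
    luxNorm Φ f Q ≠ ⊤ := by
  intro htop
  have hle := volume_rpow_mul_luxNorm_le_fracMaximal (γ := γ) (Φ := Φ) (f := f) hy
  rw [htop, ENNReal.mul_top (Q.volume_toSet_rpow_ne_zero γ)] at hle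
  exact hM (top_le_iff.1 hle)

theorem lintegral_enorm_mul_le_fracMaximal (hf : AEStronglyMeasurable f volume) (hy : y ∈ Q.toSet)
    (hgA : luxNorm (fun t => A t) g Q ≠ ⊤) (hM : fracMaximal γ (conjugate A) f y ≠ ⊤) :
    ∫⁻ z in Q.toSet, ‖g z‖ₑ * ‖f z‖ₑ ≤ 2 * fracMaximal γ (conjugate A) f y *
      (volume Q.toSet ^ (1 - γ) * luxNorm (fun t => A t) g Q) := by
  have hvol : volume Q.toSet = volume Q.toSet ^ (1 - γ) * volume Q.toSet ^ γ := by
    rw [← ENNReal.rpow_add _ _ Q.volume_toSet_ne_zero Q.volume_toSet_ne_top, sub_add_cancel,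
      ENNReal.rpow_one]
  calc ∫⁻ z in Q.toSet, ‖g z‖ₑ * ‖f z‖ₑ
      ≤ 2 * volume Q.toSet * (luxNorm (fun t => A t) g Q * luxNorm (conjugate A) f Q) :=
        lintegral_enorm_mul_le_luxNorm_mul_luxNorm hf hgA
          (luxNorm_ne_top_of_fracMaximal_ne_top hy hM)
    _ = 2 * (volume Q.toSet ^ γ * luxNorm (conjugate A) f Q) *
          (volume Q.toSet ^ (1 - γ) * luxNorm (fun t => A t) g Q) := by
        conv_lhs => rw [hvol]
        ring
    _ ≤ _ := by
        gcongr
        exact volume_rpow_mul_luxNorm_le_fracMaximal hy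

theorem lintegral_enorm_le_fracMaximal (hf : AEStronglyMeasurable f volume) (hy : y ∈ Q.toSet)
    {t : ℝ≥0} (ht : 0 < t) (hAt : A t ≤ 1) (hM : fracMaximal γ (conjugate A) f y ≠ ⊤) :
    ∫⁻ z in Q.toSet, ‖f z‖ₑ ≤
      2 * fracMaximal γ (conjugate A) f y * (volume Q.toSet ^ (1 - γ) * (t⁻¹ : ℝ≥0)) := by
  have hone : luxNorm (fun t => A t) (fun _ => (1 : 𝕜)) Q ≤ (t⁻¹ : ℝ≥0) :=
    luxNorm_one_le ht (mod_cast hAt)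
  calc ∫⁻ z in Q.toSet, ‖f z‖ₑ
      = ∫⁻ z in Q.toSet, ‖(1 : 𝕜)‖ₑ * ‖f z‖ₑ := by simp only [enorm_one, one_mul]
    _ ≤ _ := lintegral_enorm_mul_le_fracMaximal hf hy
        (ne_top_of_le_ne_top ENNReal.coe_ne_top hone) hM
    _ ≤ _ := by gcongr

theorem lintegral_annulus_enorm_mul_le_fracMaximal (hf : AEStronglyMeasurable f volume)
    (hy : y ∈ Q.toSet) (j : ℕ)
    (hgA : luxNorm (fun t => A t) ((Q.annulus j).indicator g) (Q.dyadicDilate (j + 2)) ≠ ⊤)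
    (hM : fracMaximal γ (conjugate A) f y ≠ ⊤) :
    ∫⁻ z in Q.annulus j, ‖g z‖ₑ * ‖f z‖ₑ ≤ 2 * fracMaximal γ (conjugate A) f y *
      (volume (Q.dyadicDilate (j + 2)).toSet ^ (1 - γ) *
        luxNorm (fun t => A t) ((Q.annulus j).indicator g) (Q.dyadicDilate (j + 2))) :=
  calc ∫⁻ z in Q.annulus j, ‖g z‖ₑ * ‖f z‖ₑ
      = ∫⁻ z in Q.annulus j, ‖(Q.annulus j).indicator g z‖ₑ * ‖f z‖ₑ :=
        setLIntegral_congr_fun (Q.measurableSet_annulus j) fun z hz => by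
          simp only [Set.indicator_of_mem hz]
    _ ≤ ∫⁻ z in (Q.dyadicDilate (j + 2)).toSet, ‖(Q.annulus j).indicator g z‖ₑ * ‖f z‖ₑ :=
        lintegral_mono_set (Q.annulus_subset j)
    _ ≤ _ := lintegral_enorm_mul_le_fracMaximal hf (Q.subset_dyadicDilate _ hy) hgA hM

theorem lintegral_compl_enorm_mul_le_fracMaximal (hf : AEStronglyMeasurable f volume)
    (hy : y ∈ Q.toSet) {c : ℝ≥0∞} (hc : c ≠ ⊤)
    (hg : ∑' j, volume (Q.dyadicDilate (j + 2)).toSet ^ (1 - γ) *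
      luxNorm (fun t => A t) ((Q.annulus j).indicator g) (Q.dyadicDilate (j + 2)) ≤ c)
    (hM : fracMaximal γ (conjugate A) f y ≠ ⊤) :
    ∫⁻ z in (Q.dyadicDilate 1).toSetᶜ, ‖g z‖ₑ * ‖f z‖ₑ ≤
      2 * fracMaximal γ (conjugate A) f y * c := by
  have hgA (j : ℕ) :
      luxNorm (fun t => A t) ((Q.annulus j).indicator g) (Q.dyadicDilate (j + 2)) ≠ ⊤ := by
    have hterm := ne_top_of_le_ne_top hc ((ENNReal.le_tsum j).trans hg)
    exact fun htop => hterm (by rw [htop, ENNReal.mul_top (Cube.volume_toSet_rpow_ne_zero _ _)])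
  calc ∫⁻ z in (Q.dyadicDilate 1).toSetᶜ, ‖g z‖ₑ * ‖f z‖ₑ
      ≤ ∫⁻ z in ⋃ j, Q.annulus j, ‖g z‖ₑ * ‖f z‖ₑ :=
        lintegral_mono_set Q.compl_dyadicDilate_one_subset_iUnion_annulus
    _ ≤ ∑' j, ∫⁻ z in Q.annulus j, ‖g z‖ₑ * ‖f z‖ₑ := lintegral_iUnion_le _ _
    _ ≤ ∑' j, 2 * fracMaximal γ (conjugate A) f y *
          (volume (Q.dyadicDilate (j + 2)).toSet ^ (1 - γ) *
            luxNorm (fun t => A t) ((Q.annulus j).indicator g) (Q.dyadicDilate (j + 2))) :=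
        ENNReal.tsum_le_tsum fun j =>
          lintegral_annulus_enorm_mul_le_fracMaximal hf hy j (hgA j) hM
    _ ≤ 2 * fracMaximal γ (conjugate A) f y * c := by rw [ENNReal.tsum_mul_left]; gcongr

end FracMaximal

section LocalOsc

variable {s : ℝ} {f g : (Fin n → ℝ) → 𝕜}

/-- The oscillation functional `inf_c inf {α ≥ 0 : |{y ∈ Q : |f y - c| > α}| < s |Q|}` of a single
cube, whose supremum over the cubes `Q` with `x ∈ Q ⊆ Q₀` is `localSharp s Q₀ f x`. -/
noncomputable def localOsc (s : ℝ) (f : (Fin n → ℝ) → 𝕜) (Q : Cube n) : ℝ≥0∞ :=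
  ⨅ (c : 𝕜) (α : ℝ≥0)
    (_ : volume {y | y ∈ Q.toSet ∧ (α : ℝ) < ‖f y - c‖} < ENNReal.ofReal s * volume Q.toSet),
    (α : ℝ≥0∞)

theorem localOsc_le_add {Q : Cube n} {c : 𝕜} {t b : ℝ≥0}
    (hclose : ∀ᵐ v, v ∈ Q.toSet → ‖f v - g v - c‖ ≤ b)
    (hg : volume {v | (t : ℝ) < ‖g v‖} < ENNReal.ofReal s * volume Q.toSet) :
    localOsc s f Q ≤ t + b := by
  refine iInf₂_le_of_le c (t + b) (iInf_le_of_le ((measure_mono_ae ?_).trans_lt hg) (by simp))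
  filter_upwards [hclose] with v hv
  rintro ⟨hvQ, hlarge⟩
  have htri : ‖f v - c‖ ≤ ‖g v‖ + ‖f v - g v - c‖ := by
    simpa only [sub_right_comm (f v), add_sub_cancel] using norm_add_le (g v) (f v - g v - c)
  rw [NNReal.coe_add] at hlarge
  exact lt_of_add_lt_add_right (hlarge.trans_le (htri.trans (by gcongr; exact hv hvQ)))

theorem localSharp_le_mul_iSup_iInf {F : (Fin n → ℝ) → ℝ≥0∞} {c : ℝ≥0}
    (h : ∀ Q : Cube n, ∀ y ∈ Q.toSet, localOsc s f Q ≤ c * F y) (Q₀ : Cube n) (x : Fin n → ℝ) :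
    localSharp s Q₀ f x ≤
      c * ⨆ (Q : Cube n) (_ : x ∈ Q.toSet) (_ : Q.toSet ⊆ Q₀.toSet), ⨅ y ∈ Q.toSet, F y := by
  simp only [ENNReal.mul_iSup]
  refine iSup_mono fun Q => iSup_mono fun hx => iSup_mono fun _ => ?_
  rw [iInf_subtype', ENNReal.mul_iInf' (fun h => absurd h ENNReal.coe_ne_top) (fun _ => ⟨x, hx⟩)]
  exact le_iInf fun y => h Q y y.2

end LocalOsc

section Operator

variable {k : (Fin n → ℝ) → (Fin n → ℝ) → 𝕜} {f : (Fin n → ℝ) → 𝕜} {S : Set (Fin n → ℝ)}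

theorem InDomain.indicator (hf : InDomain k f) (hS : MeasurableSet S) :
    InDomain k (S.indicator f) := by
  refine ⟨hf.1.indicator hS, hf.2.mono fun x hx => ?_⟩
  simpa only [← Set.indicator_mul_right] using hx.indicator hS

theorem intOp_eq_intOp_indicator_add_setIntegral_compl {x : Fin n → ℝ}
    (hx : Integrable (fun y => k x y * f y) volume) (hS : MeasurableSet S) :
    intOp k f x = intOp k (S.indicator f) x + ∫ y in Sᶜ, k x y * f y := by
  rw [intOp, intOp, ← integral_add_compl hS hx, ← integral_indicator hS]
  simp only [Set.indicator_mul_right]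

variable {γ : ℝ} {A : ℝ≥0 → ℝ≥0}

theorem exists_mul_volume_rpow_intOp_indicator_le (hγ : γ < 1)
    (hA : Tendsto A (𝓝 0) (𝓝 0)) (hweak : IsWeakType k 1 (1 / (1 - γ))) :
    ∃ D : ℝ≥0, ∀ f, InDomain k f → ∀ Q : Cube n, ∀ y ∈ Q.toSet,
      fracMaximal γ (conjugate A) f y ≠ ⊤ → ∀ t : ℝ≥0, 0 < t →
        t * volume {x | t < ‖intOp k ((Q.dyadicDilate 1).toSet.indicator f) x‖} ^ (1 - γ) ≤
          D * fracMaximal γ (conjugate A) f y * volume Q.toSet ^ (1 - γ) := by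
  obtain ⟨C, hC⟩ := hweak
  obtain ⟨r, hAr, hr⟩ : ∃ r, A r < 1 ∧ 0 < r :=
    (((hA.mono_left nhdsWithin_le_nhds).eventually_lt_const one_pos).and
      self_mem_nhdsWithin : ∀ᶠ r in 𝓝[>] (0 : ℝ≥0), A r < 1 ∧ 0 < r).exists
  have hγ' : 0 ≤ 1 - γ := (sub_pos.2 hγ).le
  refine ⟨C * (2 * (2 ^ n) ^ (1 - γ) * r⁻¹), fun f hf Q y hy hM t ht => ?_⟩
  set Q' := Q.dyadicDilate 1
  have hint : ∫⁻ z in Q'.toSet, ‖f z‖ₑ ≤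
      2 * fracMaximal γ (conjugate A) f y * (volume Q'.toSet ^ (1 - γ) * (r⁻¹ : ℝ≥0)) :=
    lintegral_enorm_le_fracMaximal hf.1 (Q.subset_dyadicDilate 1 hy) hr hAr.le hM
  have hnear : InDomain k (Q'.toSet.indicator f) := hf.indicator Q'.measurableSet_toSet
  have hnorm : eLpNorm (Q'.toSet.indicator f) 1 volume = ∫⁻ z in Q'.toSet, ‖f z‖ₑ := by
    rw [eLpNorm_indicator_eq_eLpNorm_restrict Q'.measurableSet_toSet,
      eLpNorm_one_eq_lintegral_enorm]
  have hLp : MemLp (Q'.toSet.indicator f) 1 volume := by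
    refine ⟨hnear.1, hnorm ▸ hint.trans_lt ?_⟩
    have := Q'.volume_toSet_rpow_ne_top (1 - γ)
    finiteness
  calc t * volume {x | t < ‖intOp k (Q'.toSet.indicator f) x‖} ^ (1 - γ)
      ≤ C * ∫⁻ z in Q'.toSet, ‖f z‖ₑ := by
        simpa only [one_div_one_div, hnorm] using hC _ hnear hLp t ht
    _ ≤ C * (2 * fracMaximal γ (conjugate A) f y *
          (volume Q'.toSet ^ (1 - γ) * (r⁻¹ : ℝ≥0))) := by gcongr
    _ = _ := by
        rw [Q.volume_dyadicDilate 1, ENNReal.mul_rpow_of_nonneg _ _ hγ', pow_one]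
        push_cast [ENNReal.coe_rpow_of_nonneg _ hγ']
        ring

theorem exists_volume_intOp_indicator_lt (hγ : γ < 1) (hA : Tendsto A (𝓝 0) (𝓝 0))
    (hweak : IsWeakType k 1 (1 / (1 - γ))) {s : ℝ} (hs : 0 < s) :
    ∃ K : ℝ≥0, ∀ f, InDomain k f → ∀ Q : Cube n, ∀ y ∈ Q.toSet,
      fracMaximal γ (conjugate A) f y ≠ ⊤ →
        ∀ t : ℝ≥0, K * fracMaximal γ (conjugate A) f y < t →
          volume {x | t < ‖intOp k ((Q.dyadicDilate 1).toSet.indicator f) x‖} <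
            ENNReal.ofReal s * volume Q.toSet := by
  obtain ⟨D, hD⟩ := exists_mul_volume_rpow_intOp_indicator_le hγ hA hweak
  have hγ' : 0 ≤ 1 - γ := (sub_pos.2 hγ).le
  have hσ : 0 < s.toNNReal ^ (1 - γ) := NNReal.rpow_pos (Real.toNNReal_pos.2 hs)
  refine ⟨D / s.toNNReal ^ (1 - γ), fun f hf Q y hy hM t ht => ?_⟩
  have hσ' : ENNReal.ofReal s ^ (1 - γ) = (s.toNNReal ^ (1 - γ) : ℝ≥0) :=
    (ENNReal.coe_rpow_of_nonneg _ hγ').symm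
  by_contra! hlarge
  refine ht.not_ge ?_
  have hmul : t * (s.toNNReal ^ (1 - γ) : ℝ≥0) * volume Q.toSet ^ (1 - γ) ≤
      D * fracMaximal γ (conjugate A) f y * volume Q.toSet ^ (1 - γ) :=
    calc t * (s.toNNReal ^ (1 - γ) : ℝ≥0) * volume Q.toSet ^ (1 - γ)
        = t * (ENNReal.ofReal s * volume Q.toSet) ^ (1 - γ) := by
          rw [ENNReal.mul_rpow_of_nonneg _ _ hγ', hσ', mul_assoc]
      _ ≤ _ := by gcongr
      _ ≤ _ := hD f hf Q y hy hM t (ENNReal.coe_pos.1 (bot_le.trans_lt ht))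
  rw [ENNReal.mul_le_mul_iff_left (Q.volume_toSet_rpow_ne_zero _) (Q.volume_toSet_rpow_ne_top _),
    ← ENNReal.le_div_iff_mul_le (.inl (by positivity)) (.inl ENNReal.coe_ne_top)] at hmul
  rwa [ENNReal.coe_div hσ.ne', ← ENNReal.mul_div_right_comm]

theorem exists_ae_norm_setIntegral_compl_sub_le (hhor : IsHormander γ A k) :
    ∃ B : ℝ≥0, ∀ f, InDomain k f → ∀ Q : Cube n, ∀ y ∈ Q.toSet,
      fracMaximal γ (conjugate A) f y ≠ ⊤ → ∃ c : 𝕜, ∀ᵐ v, v ∈ Q.toSet →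
        ‖(∫ z in (Q.dyadicDilate 1).toSetᶜ, k v z * f z) - c‖ₑ ≤
          B * fracMaximal γ (conjugate A) f y := by
  obtain ⟨B, hB⟩ := hhor
  refine ⟨2 * B, fun f hf Q y hy hM => ?_⟩
  obtain ⟨u, huQ, hu⟩ : ∃ u ∈ Q.toSet, Integrable (fun z => k u z * f z) volume :=
    ((frequently_ae_mem_iff.2 Q.volume_toSet_ne_zero).and_eventually hf.2).exists
  refine ⟨∫ z in (Q.dyadicDilate 1).toSetᶜ, k u z * f z, ?_⟩
  filter_upwards [hf.2] with v hv hvQ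
  rw [← integral_sub hv.integrableOn hu.integrableOn]
  calc ‖∫ z in (Q.dyadicDilate 1).toSetᶜ, (k v z * f z - k u z * f z)‖ₑ
      ≤ ∫⁻ z in (Q.dyadicDilate 1).toSetᶜ, ‖k v z * f z - k u z * f z‖ₑ :=
        enorm_integral_le_lintegral_enorm _
    _ = ∫⁻ z in (Q.dyadicDilate 1).toSetᶜ, ‖k v z - k u z‖ₑ * ‖f z‖ₑ := by
        simp only [← sub_mul, enorm_mul]
    _ ≤ 2 * fracMaximal γ (conjugate A) f y * B :=
        lintegral_compl_enorm_mul_le_fracMaximal hf.1 hy ENNReal.coe_ne_top (hB Q v hvQ u huQ) hM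
    _ = (2 * B : ℝ≥0) * fracMaximal γ (conjugate A) f y := by push_cast; ring

theorem exists_localOsc_intOp_le (hγ : γ < 1) (hA : Tendsto A (𝓝 0) (𝓝 0))
    (hweak : IsWeakType k 1 (1 / (1 - γ))) (hhor : IsHormander γ A k) {s : ℝ} (hs : 0 < s) :
    ∃ c : ℝ≥0, ∀ f, InDomain k f → ∀ Q : Cube n, ∀ y ∈ Q.toSet,
      localOsc s (intOp k f) Q ≤ c * fracMaximal γ (conjugate A) f y := by
  obtain ⟨K, hK⟩ := exists_volume_intOp_indicator_lt hγ hA hweak hs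
  obtain ⟨B, hB⟩ := exists_ae_norm_setIntegral_compl_sub_le hhor
  refine ⟨K + B + 1, fun f hf Q y hy => ?_⟩
  -- `0 * ∞ = 0`, so the constant has to be positive when the maximal function is infinite.
  rcases eq_or_ne (fracMaximal γ (conjugate A) f y) ⊤ with htop | htop
  · simp [htop]
  obtain ⟨c, hc⟩ := hB f hf Q y hy htop
  have hnear := hK f hf Q y hy htop
  lift fracMaximal γ (conjugate A) f y to ℝ≥0 using htop with M
  have hclose : ∀ᵐ v, v ∈ Q.toSet →
      ‖intOp k f v - intOp k ((Q.dyadicDilate 1).toSet.indicator f) v - c‖ ≤ (B * M : ℝ≥0) := by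
    filter_upwards [hf.2, hc] with v hv hcv hvQ
    rw [intOp_eq_intOp_indicator_add_setIntegral_compl hv (Q.dyadicDilate 1).measurableSet_toSet,
      add_sub_cancel_left, ← coe_nnnorm, NNReal.coe_le_coe]
    exact_mod_cast hcv hvQ
  have hosc : localOsc s (intOp k f) Q ≤ K * M + B * M := by
    refine ENNReal.le_of_forall_pos_le_add fun ε hε _ => ?_
    have hlt : (K * M : ℝ≥0∞) < (K * M + ε : ℝ≥0) := by
      exact_mod_cast lt_add_of_pos_right (K * M) hε
    refine (localOsc_le_add hclose (hnear _ hlt)).trans_eq ?_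
    push_cast
    ring
  calc localOsc s (intOp k f) Q ≤ K * M + B * M := hosc
    _ ≤ (K + B + 1 : ℝ≥0) * M := by
      rw [← add_mul]
      gcongr
      exact_mod_cast le_self_add

end Operator

end FracInt

theorem theorem2p2_general {n : ℕ} {𝕜 : Type*} [RCLike 𝕜] {γ : ℝ} (hγ : γ < 1) {A : ℝ≥0 → ℝ≥0}
    (hA : Tendsto A (𝓝 0) (𝓝 0)) {k : (Fin n → ℝ) → (Fin n → ℝ) → 𝕜}
    (hweak : FracInt.IsWeakType k 1 (1 / (1 - γ))) (hhor : FracInt.IsHormander γ A k)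
    {s : ℝ} (hs : 0 < s) :
    ∃ c : ℝ≥0, ∀ f : (Fin n → ℝ) → 𝕜, FracInt.InDomain k f →
      ∀ (Q₀ : FracInt.Cube n) (x : Fin n → ℝ),
        FracInt.localSharp s Q₀ (FracInt.intOp k f) x ≤
          c * ⨆ (Q : FracInt.Cube n) (_ : x ∈ Q.toSet) (_ : Q.toSet ⊆ Q₀.toSet),
            ⨅ y ∈ Q.toSet, FracInt.fracMaximal γ (FracInt.conjugate A) f y := by
  obtain ⟨c, hc⟩ := FracInt.exists_localOsc_intOp_le hγ hA hweak hhor hs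
  exact ⟨c, fun f hf => FracInt.localSharp_le_mul_iSup_iInf (hc f hf)⟩

theorem theorem2p2 {n : ℕ} {𝕜 : Type*} [RCLike 𝕜] (γ : ℝ) (hγ0 : 0 < γ) (hγ1 : γ < 1)
    (A : ℝ≥0 → ℝ≥0) (hA : FracInt.IsYoung A)
    (k : (Fin n → ℝ) → (Fin n → ℝ) → 𝕜)
    (hk : AEStronglyMeasurable (Function.uncurry k) (volume.prod volume))
    (hweak : FracInt.IsWeakType k 1 (1 / (1 - γ)))
    (hhor : FracInt.IsHormander γ A k)
    (s : ℝ) (hs0 : 0 < s) (hs : s ≤ 1 / 2) :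
    ∃ c : ℝ≥0, ∀ f : (Fin n → ℝ) → 𝕜, FracInt.InDomain k f →
      ∀ Q₀ : FracInt.Cube n, ∀ x ∈ Q₀.toSet,
        FracInt.localSharp s Q₀ (FracInt.intOp k f) x ≤
          c * ⨆ (Q : FracInt.Cube n) (_ : x ∈ Q.toSet) (_ : Q.toSet ⊆ Q₀.toSet),
            ⨅ y ∈ Q.toSet,
              FracInt.fracMaximal γ (FracInt.conjugate A) f y := by
  exact (theorem2p2_general hγ1 (hA.continuous.tendsto' 0 0 hA.map_zero) hweak hhor hs0).imp
    fun _ hc f hf Q₀ x _ => hc f hf Q₀ x
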